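/- Let $I>J=R\ge 2$ be integers. For an array $\mathcal{Y}\in\mathbb{R}^{I\times J\times 2}$ with frontal slices $\mathbf{Y}_1,\mathbf{Y}_2\in\mathbb{R}^{I\times J}$, let $\|\mathcal{Y}\|_F$ be the Frobenius norm and let $\mathrm{rank}(\mathcal{Y})$ be the smallest number of rank-1 arrays (outer products $\mathbf{a}\circ\mathbf{b}\circ\mathbf{c}$ of nonzero real vectors) whose sum is $\mathcal{Y}$; the same definition is used for $R\times R\times 2$ arrays. Put $$W_R(I,J,2)=\{\mathcal{Y}\in\mathbb{R}^{I\times J\times 2}:\ \mathrm{rank}([\mathbf{Y}_1\,|\,\mathbf{Y}_2])\le R\},$$ where $[\mathbf{Y}_1\,|\,\mathbf{Y}_2]$ is the $I\times 2J$ matrix formed by the two slices. The GSD problem for $\mathcal{Z}$ is to minimize $$\sum_{k=1}^2\|\mathbf{Z}_k-\mathbf{Q}_a\mathbf{R}_k\mathbf{Q}_b^T\|_F^2$$ over $\mathbf{Q}_a\in\mathbb{R}^{I\times R}$ and $\mathbf{Q}_b\in\mathbb{R}^{J\times R}$ with $\mathbf{Q}_a^T\mathbf{Q}_a=\mathbf{Q}_b^T\mathbf{Q}_b=\mathbf{I}_R$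 and upper triangular $\mathbf{R}_1,\mathbf{R}_2\in\mathbb{R}^{R\times R}$. Then for a generic $\mathcal{Z}\in\mathbb{R}^{I\times J\times 2}$ (that is, for all $\mathcal{Z}$ outside a set of Lebesgue measure zero) the problem $\min_{\mathcal{Y}\in W_R(I,J,2)}\|\mathcal{Z}-\mathcal{Y}\|_F^2$ has a unique optimal solution $\mathcal{X}$, and the following holds. Let $(\mathbf{Q}_a,\mathbf{Q}_b,\mathbf{R}_1,\mathbf{R}_2)$ be any optimal solution of the GSD problem for which, with $\tilde{\mathbf{z}}_{(m,n)}=\big((\mathbf{Q}_a^T\mathbf{Z}_1\mathbf{Q}_b)_{mn},(\mathbf{Q}_a^T\mathbf{Z}_2\mathbf{Q}_b)_{mn}\big)^T\in\mathbb{R}^2$, the second-order conditions are strictly positive: $$\sum_{r=i}^{j-1}\|\tilde{\mathbf{z}}_{(i,r)}\|^2-\sum_{r=i}^{j-1}\|\tilde{\mathbf{z}}_{(j,r)}\|^2>0 \quad\text{and}\quad \sum_{r=i+1}^{j}\|\tilde{\mathbf{z}}_{(r,j)}\|^2-\sum_{r=i+1}^{j}\|\tilde{\mathbf{z}}_{(r,i)}\|^2>0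 \qquad(1\le i<j\le R).$$ If $\mathrm{rank}(\mathcal{X})>R$, then the $R\times R\times 2$ array $\mathcal{R}$ with slices $\mathbf{R}_1$ and $\mathbf{R}_2$ satisfies $\mathrm{rank}(\mathcal{R})>R$. -/

import Mathlib

open MeasureTheory
open scoped Matrix

/-- Real three-way arrays of size `I × J × K`; `Y i j k` is the entry in row `i` and column `j`
of the `k`-th frontal slice. -/
abbrev ThreeWay (I J K : ℕ) : Type := Fin I → Fin J → Fin K → ℝ

namespace ThreeWay

/-- The `k`-th frontal slice. -/
def slice {I J K : ℕ} (Y : ThreeWay I J K) (k : Fin K) : Matrix (Fin I) (Fin J) ℝ :=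
  Matrix.of fun i j => Y i j k

/-- The array with prescribed frontal slices. -/
def ofSlices {I J K : ℕ} (M : Fin K → Matrix (Fin I) (Fin J) ℝ) : ThreeWay I J K :=
  fun i j k => M k i j

/-- Rank-one arrays: outer products of three nonzero vectors. -/
def IsRankOne {I J K : ℕ} (Y : ThreeWay I J K) : Prop :=
  ∃ (a : Fin I → ℝ) (b : Fin J → ℝ) (c : Fin K → ℝ),
    a ≠ 0 ∧ b ≠ 0 ∧ c ≠ 0 ∧ ∀ i j k, Y i j k = a i * b j * c k

/-- `Y` is a sum of exactly `n` rank-one arrays. -/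
def IsSumOfRankOnes {I J K : ℕ} (n : ℕ) (Y : ThreeWay I J K) : Prop :=
  ∃ T : Fin n → ThreeWay I J K, (∀ r, IsRankOne (T r)) ∧ Y = ∑ r, T r

/-- The rank of a three-way array: the smallest number of rank-one arrays whose sum is the
array. -/
noncomputable def rank {I J K : ℕ} (Y : ThreeWay I J K) : ℕ :=
  sInf {n : ℕ | IsSumOfRankOnes n Y}

/-- Every array is a finite sum of rank-one arrays, so the infimum in `rank` is attained. -/
theorem isSumOfRankOnes_rank {I J K : ℕ} (Y : ThreeWay I J K) :
    IsSumOfRankOnes (rank Y) Y := by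
  classical
  have zero : IsSumOfRankOnes 0 (0 : ThreeWay I J K) := ⟨fun r => r.elim0, fun r => r.elim0, by simp⟩
  have add : ∀ A B : ThreeWay I J K, (∃ n, IsSumOfRankOnes n A) → (∃ n, IsSumOfRankOnes n B) →
      ∃ n, IsSumOfRankOnes n (A + B) := by
    rintro A B ⟨m, S, hS, rfl⟩ ⟨n, T, hT, rfl⟩
    refine ⟨m + n, Fin.append S T, fun r => ?_, ?_⟩
    · refine Fin.addCases (fun i => ?_) (fun i => ?_) r
      · simpa using hS i
      · simpa using hT i
    · simp [Fin.sum_univ_add]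
  have sum : ∀ {ι : Type} (s : Finset ι) (f : ι → ThreeWay I J K),
      (∀ x ∈ s, ∃ n, IsSumOfRankOnes n (f x)) → ∃ n, IsSumOfRankOnes n (∑ x ∈ s, f x) := by
    intro ι s f h
    exact Finset.sum_induction f (fun A => ∃ n, IsSumOfRankOnes n A) add ⟨0, zero⟩ h
  have single : ∀ (p : Fin I × Fin J × Fin K), ∃ n, IsSumOfRankOnes n
      ((fun i j k => if (i, j, k) = p then Y i j k else 0) : ThreeWay I J K) := by
    rintro ⟨i₀, j₀, k₀⟩
    by_cases hy : Y i₀ j₀ k₀ = 0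
    · refine ⟨0, ?_⟩
      convert zero using 1
      funext i j k
      simp only [Prod.mk.injEq, Pi.zero_apply]
      split_ifs with h
      · obtain ⟨rfl, rfl, rfl⟩ := h
        exact hy
      · rfl
    · refine ⟨1, fun _ => _, fun _ => ⟨Pi.single i₀ (Y i₀ j₀ k₀), Pi.single j₀ 1, Pi.single k₀ 1,
        by simpa using hy, by simp, by simp, fun i j k => ?_⟩, by simp; rfl⟩
      by_cases h1 : i = i₀ <;> by_cases h2 : j = j₀ <;> by_cases h3 : k = k₀ <;>
        simp [h1, h2, h3]
  have hne : {n : ℕ | IsSumOfRankOnes n Y}.Nonempty := by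
    have hY : Y = ∑ p : Fin I × Fin J × Fin K,
        ((fun i j k => if (i, j, k) = p then Y i j k else 0) : ThreeWay I J K) := by
      funext i j k
      simp [Finset.sum_apply]
    rw [hY]
    exact sum Finset.univ _ (fun p _ => single p)
  exact Nat.sInf_mem hne

/-- The squared Frobenius norm. -/
def frobSq {I J K : ℕ} (Y : ThreeWay I J K) : ℝ := ∑ i, ∑ j, ∑ k, Y i j k ^ 2

/-- The set `W_R(I,J,2)`: the arrays for which the `I × 2J` matrix `[Y₁ | Y₂]` has rank at
most `R`. -/
def W (I J R : ℕ) : Set (ThreeWay I J 2) :=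
  {Y | (Matrix.fromCols (Y.slice 0) (Y.slice 1)).rank ≤ R}

/-- `X` is an optimal solution of `min {‖Z - Y‖²_F : Y ∈ W_R(I,J,2)}`. -/
def IsBestFromW {I J : ℕ} (R : ℕ) (Z X : ThreeWay I J 2) : Prop :=
  X ∈ W I J R ∧ ∀ Y ∈ W I J R, frobSq (Z - X) ≤ frobSq (Z - Y)

end ThreeWay

/-- Candidate generalized Schur decompositions: `Q_a`, `Q_b` and the matrices `R_1`, `R_2`
(which are `Rm 0`, `Rm 1`). -/
structure GSD (I J R : ℕ) where
  Qa : Matrix (Fin I) (Fin R) ℝ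
  Qb : Matrix (Fin J) (Fin R) ℝ
  Rm : Fin 2 → Matrix (Fin R) (Fin R) ℝ

namespace GSD

/-- The constraints: `Q_a`, `Q_b` columnwise orthonormal, `R_1`, `R_2` upper triangular. -/
def Feasible {I J R : ℕ} (G : GSD I J R) : Prop :=
  G.Qaᵀ * G.Qa = 1 ∧ G.Qbᵀ * G.Qb = 1 ∧ ∀ k, (G.Rm k).BlockTriangular id

/-- The array with slices `Q_a R_k Q_bᵀ`. -/
def toArray {I J R : ℕ} (G : GSD I J R) : ThreeWay I J 2 :=
  ThreeWay.ofSlices fun k => G.Qa * G.Rm k * G.Qbᵀ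

/-- Optimal solutions of the problem of minimizing `∑ₖ ‖Z_k - Q_a R_k Q_bᵀ‖²_F` subject to the
constraints. -/
def IsOptimal {I J R : ℕ} (Z : ThreeWay I J 2) (G : GSD I J R) : Prop :=
  G.Feasible ∧ ∀ G' : GSD I J R, G'.Feasible →
    ThreeWay.frobSq (Z - G.toArray) ≤ ThreeWay.frobSq (Z - G'.toArray)

/-- The squared length of the vector `((Q_aᵀ Z_1 Q_b)_{mn}, (Q_aᵀ Z_2 Q_b)_{mn})`. -/
noncomputable def tildeSq {I J R : ℕ} (Z : ThreeWay I J 2) (G : GSD I J R) (m n : Fin R) : ℝ :=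
  ∑ k : Fin 2, ((G.Qaᵀ * Z.slice k * G.Qb) m n) ^ 2

/-- The second-order conditions for the Givens rotations of rows `i < j` and of columns `i < j`
hold with strict inequality. -/
def StrictSecondOrder {I J R : ℕ} (Z : ThreeWay I J 2) (G : GSD I J R) : Prop :=
  ∀ i j : Fin R, i < j →
    0 < ∑ r ∈ Finset.Ico i j, tildeSq Z G i r - ∑ r ∈ Finset.Ico i j, tildeSq Z G j r ∧
    0 < ∑ r ∈ Finset.Ioc i j, tildeSq Z G r j - ∑ r ∈ Finset.Ioc i j, tildeSq Z G r i

end GSD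

/-! The proof is by contraposition. If the triangular array has rank at most R, the optimal GSD
already solves the relaxed problem over `W` (`GSD.IsOptimal.isBestFromW`). By uniqueness it is then
X, and rank X ≤ R since multiplying by `Qa` and `Qb` does not raise the rank.

Uniqueness for almost every Z: the distance to `W` is Lipschitz, hence differentiable almost
everywhere, and its derivative determines the nearest point.

Relaxed optimality: since J = R, QR and RQ decompositions make every A Uₖ Bᵀ, with Uₖ triangular up
to a common permutation, a competitor of the GSD. Write the fitted slices as A diag(dₖ) Bᵀ. The
strict second-order conditions serve only to exclude a common zero on the diagonals; the pencil is
then regular, A injective and B invertible. First-order conditions make the residual Δ orthogonal to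
the row and column spaces of the fit Y. A second-order variation exchanging y in the column space
for an orthogonal u gives |y|²|Δᵀu|² ≤ |u|²|Yᵀy|²: no singular value of Δ exceeds a retained one,
which forces a best rank-R approximation (`frobInner_le_of_second_order`).

The difficulty is to keep that variation among the competitors. Entries (i, j) with non-parallel
third factors are produced by row and column operations (`exists_commutator_correction`); parallel
terms are rearranged beforehand (`exists_decomposition_nonparallel`). -/

/-! ### Frobenius inner product and optimality along curves. -/

section FrobeniusProduct

variable {m n p : Type*} [Fintype m] [Fintype n] [Fintype p]

/-- The Frobenius inner product of real matrices. -/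
def frobInner (X Y : Matrix m n ℝ) : ℝ := (Xᵀ * Y).trace

theorem frobInner_eq_sum (X Y : Matrix m n ℝ) : frobInner X Y = ∑ i, ∑ j, X i j * Y i j := by
  simp only [frobInner, Matrix.trace, Matrix.diag, Matrix.mul_apply, Matrix.transpose_apply]
  exact Finset.sum_comm

theorem frobInner_comm (X Y : Matrix m n ℝ) : frobInner X Y = frobInner Y X := by
  simp only [frobInner_eq_sum, mul_comm]

theorem frobInner_add_left (X Y T : Matrix m n ℝ) :
    frobInner (X + Y) T = frobInner X T + frobInner Y T := by
  simp [frobInner, Matrix.add_mul]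

theorem frobInner_add_right (X Y T : Matrix m n ℝ) :
    frobInner T (X + Y) = frobInner T X + frobInner T Y := by
  simp [frobInner, Matrix.mul_add]

theorem frobInner_sub_left (X Y T : Matrix m n ℝ) :
    frobInner (X - Y) T = frobInner X T - frobInner Y T := by
  simp [frobInner, Matrix.sub_mul]

theorem frobInner_sub_right (X Y T : Matrix m n ℝ) :
    frobInner T (X - Y) = frobInner T X - frobInner T Y := by
  simp [frobInner, Matrix.mul_sub]

theorem frobInner_smul_left (c : ℝ) (X Y : Matrix m n ℝ) :
    frobInner (c • X) Y = c * frobInner X Y := by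
  simp [frobInner]

theorem frobInner_smul_right (c : ℝ) (X Y : Matrix m n ℝ) :
    frobInner X (c • Y) = c * frobInner X Y := by
  simp [frobInner]

theorem frobInner_self_nonneg (X : Matrix m n ℝ) : 0 ≤ frobInner X X := by
  rw [frobInner_eq_sum]
  exact Finset.sum_nonneg fun i _ => Finset.sum_nonneg fun j _ => mul_self_nonneg _

theorem frobInner_self_eq_zero {X : Matrix m n ℝ} : frobInner X X = 0 ↔ X = 0 := by
  constructor
  · intro h
    rw [frobInner_eq_sum] at h
    ext i j
    have hi := (Finset.sum_eq_zero_iff_of_nonneg fun i _ =>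
      Finset.sum_nonneg fun j _ => mul_self_nonneg (X i j)).1 h i (Finset.mem_univ i)
    simpa using (Finset.sum_eq_zero_iff_of_nonneg fun j _ =>
      mul_self_nonneg (X i j)).1 hi j (Finset.mem_univ j)
  · rintro rfl
    simp [frobInner]

theorem frobInner_mul_left (X : Matrix m n ℝ) (A : Matrix m p ℝ) (V : Matrix p n ℝ) :
    frobInner X (A * V) = frobInner (Aᵀ * X) V := by
  simp [frobInner, Matrix.mul_assoc]

theorem frobInner_mul_right (X : Matrix m n ℝ) (A : Matrix m p ℝ) (V : Matrix p n ℝ) :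
    frobInner X (A * V) = frobInner (X * Vᵀ) A := by
  rw [frobInner, frobInner, ← Matrix.mul_assoc, Matrix.trace_mul_comm]
  simp [Matrix.mul_assoc]

theorem frobInner_vecMulVec (X : Matrix m n ℝ) (u : m → ℝ) (v : n → ℝ) :
    frobInner X (Matrix.vecMulVec u v) = u ⬝ᵥ X *ᵥ v := by
  simp only [frobInner_eq_sum, Matrix.vecMulVec_apply, dotProduct, Matrix.mulVec, Finset.mul_sum]
  exact Finset.sum_congr rfl fun i _ => Finset.sum_congr rfl fun j _ => by ring

/-- First-order condition along a line. -/
theorem frobInner_eq_zero_of_forall_le {X P : Matrix m n ℝ}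
    (h : ∀ t : ℝ, frobInner X X ≤ frobInner (X - t • P) (X - t • P)) : frobInner X P = 0 := by
  -- A nonnegative quadratic without constant term: its discriminant 4⟨X, P⟩² must be ≤ 0.
  have h' : ∀ t : ℝ, 0 ≤ frobInner P P * (t * t) + (-2 * frobInner X P) * t + 0 := by
    intro t
    have := h t
    simp only [frobInner_sub_left, frobInner_sub_right, frobInner_smul_left,
      frobInner_smul_right, frobInner_comm P X] at this
    nlinarith
  have := discrim_le_zero h'
  rw [discrim] at this
  nlinarith [sq_nonneg (frobInner X P)]

/-- Second-order condition along a polynomial curve. -/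
theorem frobInner_second_order {X P Q₀ Q₁ Q₂ : Matrix m n ℝ} (hP : frobInner X P = 0)
    (h : ∀ t : ℝ, frobInner X X ≤
      frobInner (X - (t • P + t ^ 2 • Q₀ + t ^ 3 • Q₁ + t ^ 4 • Q₂))
        (X - (t • P + t ^ 2 • Q₀ + t ^ 3 • Q₁ + t ^ 4 • Q₂))) :
    0 ≤ frobInner P P - 2 * frobInner X Q₀ := by
  -- t² c(t) is the difference of the two sides of `h`, the linear term vanishing by `hP`. The claim
  -- is 0 ≤ c(0), obtained from t ≠ 0 by continuity.
  set c : ℝ → ℝ := fun t => (frobInner P P - 2 * frobInner X Q₀) +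
    t * (2 * frobInner P Q₀ - 2 * frobInner X Q₁) +
    t ^ 2 * (frobInner Q₀ Q₀ + 2 * frobInner P Q₁ - 2 * frobInner X Q₂) +
    t ^ 3 * (2 * frobInner P Q₂ + 2 * frobInner Q₀ Q₁) +
    t ^ 4 * (frobInner Q₁ Q₁ + 2 * frobInner Q₀ Q₂) + t ^ 5 * (2 * frobInner Q₁ Q₂) +
    t ^ 6 * frobInner Q₂ Q₂ with hc
  have hpos : ∀ t : ℝ, t ≠ 0 → 0 ≤ c t := by
    intro t ht
    have h1 := h t
    simp only [frobInner_sub_left, frobInner_sub_right, frobInner_add_left, frobInner_add_right,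
      frobInner_smul_left, frobInner_smul_right, frobInner_comm P X, frobInner_comm Q₀ X,
      frobInner_comm Q₁ X, frobInner_comm Q₂ X, frobInner_comm Q₀ P, frobInner_comm Q₁ P,
      frobInner_comm Q₂ P, frobInner_comm Q₁ Q₀, frobInner_comm Q₂ Q₀, frobInner_comm Q₂ Q₁,
      hP] at h1
    have h2 : 0 ≤ t ^ 2 * c t := by
      simp only [hc]
      linarith
    exact nonneg_of_mul_nonneg_right h2 (by positivity)
  have hcont : Continuous c := by
    simp only [hc]
    fun_prop
  have hcl : IsClosed {t : ℝ | 0 ≤ c t} := isClosed_le continuous_const hcont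
  have hd : Dense ({0}ᶜ : Set ℝ) := dense_compl_singleton 0
  have : (0 : ℝ) ∈ {t : ℝ | 0 ≤ c t} :=
    hcl.closure_subset_iff.2 (fun t ht => hpos t ht) (hd 0)
  simpa [hc] using this

end FrobeniusProduct

/-! ### QR, RQ and rank factorizations. -/

section QR

/-- QR decomposition of a matrix with at least as many rows as columns. -/
theorem exists_qr {I R : ℕ} (hRI : R ≤ I) (A : Matrix (Fin I) (Fin R) ℝ) :
    ∃ (Q : Matrix (Fin I) (Fin R) ℝ) (T : Matrix (Fin R) (Fin R) ℝ),
      Qᵀ * Q = 1 ∧ T.BlockTriangular id ∧ A = Q * T := by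
  classical
  -- Padding the columns by zero vectors lets Gram–Schmidt return a full orthonormal basis, even
  -- when A is rank deficient; its first R vectors form Q.
  let f : Fin I → EuclideanSpace ℝ (Fin I) := fun i =>
    if h : (i : ℕ) < R then WithLp.toLp 2 fun k => A k ⟨i, h⟩ else 0
  have hcard : Module.finrank ℝ (EuclideanSpace ℝ (Fin I)) = Fintype.card (Fin I) := by simp
  let b := InnerProductSpace.gramSchmidtOrthonormalBasis hcard f
  have hf : ∀ r : Fin R, f (Fin.castLE hRI r) = WithLp.toLp 2 fun k => A k r := fun r => by
    simp [f]
  refine ⟨Matrix.of fun i r => b (Fin.castLE hRI r) i,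
    Matrix.of fun r s => inner ℝ (b (Fin.castLE hRI r)) (f (Fin.castLE hRI s)), ?_, ?_, ?_⟩
  · ext r s
    have := orthonormal_iff_ite.1 b.orthonormal (Fin.castLE hRI r) (Fin.castLE hRI s)
    simp only [PiLp.inner_apply, RCLike.inner_apply, conj_trivial] at this
    simp only [Matrix.mul_apply, Matrix.transpose_apply, Matrix.of_apply, Matrix.one_apply]
    simp only [Fin.ext_iff, Fin.val_castLE] at this ⊢
    rw [← this]
    exact Finset.sum_congr rfl fun i _ => mul_comm _ _
  · intro r s hrs
    simp only [Matrix.of_apply]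
    exact InnerProductSpace.gramSchmidtOrthonormalBasis_inv_triangular hcard f
      (show Fin.castLE hRI s < Fin.castLE hRI r from hrs)
  · ext i s
    have h1 : f (Fin.castLE hRI s) i = A i s := by rw [hf]
    rw [← h1, ← b.sum_repr' (f (Fin.castLE hRI s))]
    simp only [Matrix.mul_apply, Matrix.of_apply, smul_eq_mul, WithLp.ofLp_sum,
      WithLp.ofLp_smul, Finset.sum_apply, Pi.smul_apply]
    rw [← Finset.sum_subset (s₁ := Finset.univ.map (Fin.castLEEmb hRI)) (Finset.subset_univ _)]
    · rw [Finset.sum_map]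
      exact Finset.sum_congr rfl fun r _ => by simp [mul_comm]
    · intro k _ hk
      have hk' : R ≤ (k : ℕ) := by
        by_contra hlt
        push Not at hlt
        exact hk (Finset.mem_map.2 ⟨⟨k, hlt⟩, Finset.mem_univ _, by simp⟩)
      have : inner ℝ (b k) (f (Fin.castLE hRI s)) = 0 :=
        InnerProductSpace.gramSchmidtOrthonormalBasis_inv_triangular hcard f
          (by rw [Fin.lt_def]; exact lt_of_lt_of_le s.2 hk')
      simp [this]

/-- The transpose of a square matrix is the product of an upper triangular matrix and an
orthogonal matrix. -/
theorem exists_rq {R : ℕ} (B : Matrix (Fin R) (Fin R) ℝ) :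
    ∃ (Q : Matrix (Fin R) (Fin R) ℝ) (T : Matrix (Fin R) (Fin R) ℝ),
      Qᵀ * Q = 1 ∧ T.BlockTriangular id ∧ Bᵀ = T * Qᵀ := by
  -- Reversing both index orders of an upper triangular matrix makes it lower triangular, so its
  -- transpose is upper triangular again.
  obtain ⟨Q, T, hQ, hT, hB⟩ := exists_qr le_rfl (B.submatrix id Fin.rev)
  refine ⟨Q.submatrix id Fin.rev, (T.submatrix Fin.rev Fin.rev)ᵀ, ?_, ?_, ?_⟩
  · have : (Q.submatrix id Fin.rev)ᵀ * Q.submatrix id Fin.rev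
        = (Qᵀ * Q).submatrix Fin.rev Fin.rev := by
      ext i j
      simp [Matrix.mul_apply]
    rw [this, hQ]
    exact Matrix.submatrix_one _ Fin.rev_injective
  · intro i j hij
    exact hT (by simpa using hij)
  · have h2 : B = (Q * T).submatrix id Fin.rev := by
      rw [← hB]
      ext i j
      simp
    rw [← Matrix.transpose_mul]
    congr 1
    rw [h2]
    ext i j
    simp only [Matrix.submatrix_apply, Matrix.mul_apply, id]
    exact (Equiv.sum_comp Fin.revPerm (fun k => Q i k * T k j.rev)).symm

/-- A matrix of rank at most `R` factors through `ℝ^R`. -/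
theorem Matrix.exists_mul_eq_of_rank_le {m n : Type*} [Fintype m] [Fintype n] {R : ℕ}
    (M : Matrix m n ℝ) (h : M.rank ≤ R) :
    ∃ (A : Matrix m (Fin R) ℝ) (V : Matrix (Fin R) n ℝ), M = A * V := by
  classical
  have h' : Module.finrank ℝ (LinearMap.range M.mulVecLin) ≤
      Module.finrank ℝ (Fin R → ℝ) := by simpa [Matrix.rank] using h
  obtain ⟨f, hf⟩ := finrank_le_iff_exists_linearMap.1 h'
  obtain ⟨g, hg⟩ := f.exists_leftInverse_of_injective (LinearMap.ker_eq_bot.2 hf)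
  refine ⟨LinearMap.toMatrix' ((LinearMap.range M.mulVecLin).subtype ∘ₗ g),
    LinearMap.toMatrix' (f ∘ₗ M.mulVecLin.rangeRestrict), ?_⟩
  rw [← LinearMap.toMatrix'_comp]
  have : ((LinearMap.range M.mulVecLin).subtype ∘ₗ g) ∘ₗ (f ∘ₗ M.mulVecLin.rangeRestrict)
      = M.mulVecLin := by
    ext1
    refine LinearMap.ext fun x => ?_
    have := LinearMap.congr_fun hg (M.mulVecLin.rangeRestrict (Pi.single ‹_› x))
    simp only [LinearMap.comp_apply, LinearMap.id_apply] at this ⊢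
    simp [this]
  rw [this]
  exact (LinearMap.toMatrix'_toLin' M).symm

end QR

/-! ### Unfoldings and projections onto column spaces. -/

namespace ThreeWay

/-- The matrix whose columns are those of all the frontal slices. -/
def unfold {I J : ℕ} (Y : ThreeWay I J 2) : Matrix (Fin I) (Fin 2 × Fin J) ℝ :=
  Matrix.of fun i p => Y i p.2 p.1

theorem frobSq_eq {I J : ℕ} (Y : ThreeWay I J 2) : frobSq Y = frobInner Y.unfold Y.unfold := by
  simp only [frobSq, frobInner_eq_sum, unfold, Matrix.of_apply, Fintype.sum_prod_type,
    Fin.sum_univ_two, ← Finset.sum_add_distrib, sq]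

theorem unfold_sub {I J : ℕ} (Y Z : ThreeWay I J 2) : (Y - Z).unfold = Y.unfold - Z.unfold := rfl

theorem mem_W_iff {I J R : ℕ} (Y : ThreeWay I J 2) : Y ∈ W I J R ↔ Y.unfold.rank ≤ R := by
  have : Matrix.fromCols (Y.slice 0) (Y.slice 1) = Y.unfold.submatrix (Equiv.refl _)
      ((finTwoEquiv.prodCongr (Equiv.refl _)).trans (Equiv.boolProdEquivSum _)).symm := by
    ext i (j | j) <;> rfl
  rw [W, Set.mem_ofPred_eq, this, Matrix.rank_submatrix]

/-- QR of the left factor gives exactly R orthonormal columns even when the rank is smaller, so `W`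
is parametrized by frames C of a fixed size. -/
theorem exists_projection_of_mem_W {I J R : ℕ} (hRI : R ≤ I) {Y : ThreeWay I J 2}
    (hY : Y ∈ W I J R) :
    ∃ C : Matrix (Fin I) (Fin R) ℝ, Cᵀ * C = 1 ∧ Y.unfold = C * (Cᵀ * Y.unfold) := by
  obtain ⟨A, V, hAV⟩ := Matrix.exists_mul_eq_of_rank_le _ ((mem_W_iff Y).1 hY)
  obtain ⟨C, T, hC, -, rfl⟩ := exists_qr hRI A
  refine ⟨C, hC, ?_⟩
  rw [hAV, ← Matrix.mul_assoc Cᵀ, ← Matrix.mul_assoc Cᵀ, hC, Matrix.one_mul, Matrix.mul_assoc]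

theorem exists_unfold_eq {I J : ℕ} (M : Matrix (Fin I) (Fin 2 × Fin J) ℝ) :
    ∃ Y : ThreeWay I J 2, Y.unfold = M := ⟨fun i j k => M i (k, j), rfl⟩

/-- Projecting onto the columns of `C` is at least as good as any other array whose unfolding
has its columns in that span. -/
theorem frobInner_sub_projection_le {m n p : Type*} [Fintype m] [Fintype n] [Fintype p]
    [DecidableEq p] {C : Matrix m p ℝ} (hC : Cᵀ * C = 1) (M : Matrix m n ℝ) (V : Matrix p n ℝ) :
    frobInner (M - C * (Cᵀ * M)) (M - C * (Cᵀ * M)) ≤ frobInner (M - C * V) (M - C * V) := by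
  have h1 : M - C * V = (M - C * (Cᵀ * M)) + C * (Cᵀ * M - V) := by
    rw [Matrix.mul_sub]; abel
  have h2 : frobInner (M - C * (Cᵀ * M)) (C * (Cᵀ * M - V)) = 0 := by
    rw [frobInner_mul_left, Matrix.mul_sub, ← Matrix.mul_assoc Cᵀ C, hC, Matrix.one_mul, sub_self]
    simp [frobInner]
  rw [h1, frobInner_add_left, frobInner_add_right, frobInner_add_right, h2,
    frobInner_comm (C * (Cᵀ * M - V)), h2]
  linarith [frobInner_self_nonneg (C * (Cᵀ * M - V))]

end ThreeWay

/-! ### Existence and almost everywhere uniqueness of the nearest point. -/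

theorem isAddHaarMeasure_volume_pi (ι G : Type*) [Fintype ι] [NormedAddCommGroup G]
    [MeasureSpace G] [MeasurableAdd G] [SigmaFinite (volume : Measure G)]
    [(volume : Measure G).IsAddHaarMeasure] : (volume : Measure (ι → G)).IsAddHaarMeasure :=
  Measure.pi.isAddHaarMeasure fun _ => volume

theorem isCompact_setOf_transpose_mul_self_eq_one {m n : Type*} [Fintype m] [Fintype n]
    [DecidableEq n] : IsCompact {C : Matrix m n ℝ | Cᵀ * C = 1} := by
  have hK : IsCompact (Set.univ.pi fun _ : m => Set.univ.pi fun _ : n => Set.Icc (-1 : ℝ) 1) :=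
    isCompact_univ_pi fun _ => isCompact_univ_pi fun _ => isCompact_Icc
  refine IsCompact.of_isClosed_subset (X := Matrix m n ℝ) hK ?_ ?_
  · exact isClosed_eq (by fun_prop) continuous_const
  · intro C hC i _ j _
    have h1 : ∑ k, C k j * C k j = 1 := by
      have := congrFun (congrFun hC j) j
      simpa [Matrix.mul_apply] using this
    have h2 : C i j * C i j ≤ 1 := by
      rw [← h1]
      exact Finset.single_le_sum (f := fun k => C k j * C k j)
        (fun k _ => mul_self_nonneg _) (Finset.mem_univ i)
    exact ⟨by nlinarith, by nlinarith⟩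

namespace ThreeWay

/-- `W` is unbounded, but for a fixed frame C the best choice is the projection; what remains is a
continuous function on the compact set of frames. -/
theorem exists_isBestFromW {I J R : ℕ} (hRI : R ≤ I) (Z : ThreeWay I J 2) :
    ∃ X, IsBestFromW R Z X := by
  have hne : {C : Matrix (Fin I) (Fin R) ℝ | Cᵀ * C = 1}.Nonempty := by
    obtain ⟨Q, -, hQ, -⟩ := exists_qr hRI (0 : Matrix (Fin I) (Fin R) ℝ)
    exact ⟨Q, hQ⟩
  have hcont : Continuous fun C : Matrix (Fin I) (Fin R) ℝ =>
      frobInner (Z.unfold - C * (Cᵀ * Z.unfold)) (Z.unfold - C * (Cᵀ * Z.unfold)) := by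
    unfold frobInner
    fun_prop
  obtain ⟨C, hC, hmin⟩ := isCompact_setOf_transpose_mul_self_eq_one.exists_isMinOn hne
    hcont.continuousOn
  obtain ⟨X, hX⟩ := exists_unfold_eq (C * (Cᵀ * Z.unfold))
  refine ⟨X, ?_, fun Y hY => ?_⟩
  · rw [mem_W_iff, hX]
    exact (Matrix.rank_mul_le_left _ _).trans (Matrix.rank_le_width C)
  · obtain ⟨D, hD, hYD⟩ := exists_projection_of_mem_W hRI hY
    rw [frobSq_eq, frobSq_eq, unfold_sub, unfold_sub, hX, hYD]
    exact (hmin hD).trans (frobInner_sub_projection_le hD _ _)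

/-- Three-way arrays as vectors of a Euclidean space. -/
noncomputable def toEuclidean (I J K : ℕ) :
    ThreeWay I J K →L[ℝ] EuclideanSpace ℝ (Fin I × Fin J × Fin K) :=
  LinearMap.toContinuousLinearMap
    { toFun := fun Y => WithLp.toLp 2 fun p => Y p.1 p.2.1 p.2.2
      map_add' := fun _ _ => rfl
      map_smul' := fun _ _ => rfl }

theorem toEuclidean_apply {I J K : ℕ} (Y : ThreeWay I J K) (p : Fin I × Fin J × Fin K) :
    toEuclidean I J K Y p = Y p.1 p.2.1 p.2.2 := rfl

theorem frobSq_eq_norm_sq {I J K : ℕ} (Y : ThreeWay I J K) :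
    frobSq Y = ‖toEuclidean I J K Y‖ ^ 2 := by
  simp [frobSq, EuclideanSpace.norm_sq_eq, toEuclidean_apply, Fintype.sum_prod_type]

theorem toEuclidean_injective {I J K : ℕ} : Function.Injective (toEuclidean I J K) := by
  intro Y Z h
  funext i j k
  exact congrArg (fun v : EuclideanSpace ℝ (Fin I × Fin J × Fin K) => v (i, j, k)) h

/-- The distance function to `W_R(I,J,2)`. -/
noncomputable def distW {I J : ℕ} (R : ℕ) (Z : ThreeWay I J 2) : ℝ :=
  Metric.infDist (toEuclidean I J 2 Z) (toEuclidean I J 2 '' W I J R)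

theorem distW_le {I J R : ℕ} (Z : ThreeWay I J 2) {Y : ThreeWay I J 2} (hY : Y ∈ W I J R) :
    distW R Z ≤ ‖toEuclidean I J 2 (Z - Y)‖ := by
  rw [map_sub, ← dist_eq_norm]
  exact Metric.infDist_le_dist_of_mem (Set.mem_image_of_mem _ hY)

theorem IsBestFromW.distW_eq {I J R : ℕ} {Z X : ThreeWay I J 2} (h : IsBestFromW R Z X) :
    distW R Z = ‖toEuclidean I J 2 (Z - X)‖ := by
  refine le_antisymm (distW_le Z h.1) ?_
  refine (Metric.le_infDist (Set.Nonempty.image _ ⟨X, h.1⟩)).2 ?_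
  rintro _ ⟨Y, hY, rfl⟩
  rw [dist_eq_norm, ← map_sub]
  have := h.2 Y hY
  rw [frobSq_eq_norm_sq, frobSq_eq_norm_sq] at this
  exact (sq_le_sq₀ (norm_nonneg _) (norm_nonneg _)).1 this

/-- Where the distance function is differentiable, its derivative determines the nearest point. -/
theorem IsBestFromW.inner_eq {I J R : ℕ} {Z X : ThreeWay I J 2} (h : IsBestFromW R Z X)
    (hd : DifferentiableAt ℝ (distW (I := I) (J := J) R) Z) (H : ThreeWay I J 2) :
    2 * inner ℝ (toEuclidean I J 2 (Z - X)) (toEuclidean I J 2 H) =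
      2 * (distW R Z * fderiv ℝ (distW R) Z H) := by
  have h1 : HasFDerivAt (fun Z' => ‖toEuclidean I J 2 Z' - toEuclidean I J 2 X‖ ^ 2)
      (2 • (innerSL ℝ (toEuclidean I J 2 Z - toEuclidean I J 2 X)).comp (toEuclidean I J 2)) Z :=
    ((toEuclidean I J 2).hasFDerivAt.sub_const (toEuclidean I J 2 X)).norm_sq
  have h2 : HasFDerivAt (fun Z' : ThreeWay I J 2 => distW R Z' ^ 2)
      ((2 * distW R Z) • fderiv ℝ (distW R) Z) Z := by
    simpa using hd.hasFDerivAt.pow 2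
  -- The difference is nonnegative and vanishes at Z, so the two derivatives at Z agree.
  have hmin : IsLocalMin (fun Z' : ThreeWay I J 2 =>
      ‖toEuclidean I J 2 Z' - toEuclidean I J 2 X‖ ^ 2 - distW R Z' ^ 2) Z := by
    refine Filter.Eventually.of_forall fun Z' => ?_
    have h3 := distW_le Z' h.1
    have h4 : 0 ≤ distW R Z' := Metric.infDist_nonneg
    have h5 := h.distW_eq
    rw [map_sub] at h3 h5
    simp only [h5]
    nlinarith
  have h0 := congrArg (fun L => L H) (hmin.hasFDerivAt_eq_zero (h1.sub h2))
  simp only [sub_apply, smul_apply, ContinuousLinearMap.comp_apply, innerSL_apply_apply,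
    zero_apply, nsmul_eq_mul, smul_eq_mul] at h0
  rw [map_sub]
  push_cast at h0
  linarith

/-- Rademacher's theorem applies to the distance function; at a point of differentiability, two
nearest points have the same inner products with Z - X, hence coincide. -/
theorem ae_existsUnique_isBestFromW {I J R : ℕ} (hRI : R ≤ I) :
    ∀ᵐ Z : ThreeWay I J 2 ∂(volume : Measure (ThreeWay I J 2)), ∃! X, IsBestFromW R Z X := by
  have hL : LipschitzWith (1 * ‖toEuclidean I J 2‖₊) (distW (I := I) (J := J) R) :=
    (Metric.lipschitz_infDist_pt _).comp (toEuclidean I J 2).lipschitz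
  have : (volume : Measure (Fin J → Fin 2 → ℝ)).IsAddHaarMeasure :=
    isAddHaarMeasure_volume_pi (Fin J) (Fin 2 → ℝ)
  have : (volume : Measure (ThreeWay I J 2)).IsAddHaarMeasure :=
    isAddHaarMeasure_volume_pi (Fin I) (Fin J → Fin 2 → ℝ)
  filter_upwards [hL.ae_differentiableAt] with Z hZ
  obtain ⟨X, hX⟩ := exists_isBestFromW hRI Z
  refine ⟨X, hX, fun X' hX' => ?_⟩
  have h1 := (hX'.inner_eq hZ (X' - X)).trans (hX.inner_eq hZ (X' - X)).symm
  have h2 : inner ℝ (toEuclidean I J 2 (X' - X)) (toEuclidean I J 2 (X' - X)) = (0 : ℝ) := by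
    have : X' - X = (Z - X) - (Z - X') := by abel
    nth_rewrite 1 [this]
    rw [map_sub, inner_sub_left]
    linarith
  rw [inner_self_eq_zero, map_sub, sub_eq_zero] at h2
  exact toEuclidean_injective h2

end ThreeWay

/-! ### Triangular pencils as competitors of the GSD. -/

section Slices

variable {m p n : Type*}

/-- The matrix `[M₁ | M₂]` with columns indexed by pairs. -/
def joinSlices (M : Fin 2 → Matrix m n ℝ) : Matrix m (Fin 2 × n) ℝ :=
  Matrix.of fun i q => M q.1 i q.2

theorem joinSlices_apply (M : Fin 2 → Matrix m n ℝ) (i : m) (q : Fin 2 × n) :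
    joinSlices M i q = M q.1 i q.2 := rfl

theorem mul_joinSlices [Fintype p] (A : Matrix m p ℝ) (M : Fin 2 → Matrix p n ℝ) :
    A * joinSlices M = joinSlices fun k => A * M k := rfl

theorem joinSlices_add (M N : Fin 2 → Matrix m n ℝ) :
    joinSlices (fun k => M k + N k) = joinSlices M + joinSlices N := rfl

theorem joinSlices_smul (t : ℝ) (M : Fin 2 → Matrix m n ℝ) :
    joinSlices (fun k => t • M k) = t • joinSlices M := rfl

end Slices

/-- A pencil whose off-diagonal entries all lie in the rows of `S` and in the columns outside
`S`; it is triangular up to a simultaneous permutation of rows and columns. -/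
def IsTriangularAlong {R : ℕ} (S : Set (Fin R)) (U : Fin 2 → Matrix (Fin R) (Fin R) ℝ) : Prop :=
  ∀ k i j, i ≠ j → U k i j ≠ 0 → i ∈ S ∧ j ∉ S

theorem isTriangularAlong_diagonal {R : ℕ} (S : Set (Fin R)) (d : Fin 2 → Fin R → ℝ) :
    IsTriangularAlong S fun k => Matrix.diagonal (d k) :=
  fun k _ _ hij h => absurd (Matrix.diagonal_apply_ne (d k) hij) h

/-- Listing the indices of S before the others places every off-diagonal nonzero entry above the
diagonal. -/
theorem IsTriangularAlong.exists_perm {R : ℕ} {S : Set (Fin R)}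
    {U : Fin 2 → Matrix (Fin R) (Fin R) ℝ} (h : IsTriangularAlong S U) :
    ∃ e : Equiv.Perm (Fin R), ∀ k, ((U k).submatrix e e).BlockTriangular id := by
  classical
  let g : Fin R → ℕ := fun i => if i ∈ S then 0 else 1
  refine ⟨Tuple.sort g, fun k i j hij => ?_⟩
  by_contra hne
  have hij' : j < i := hij
  obtain ⟨h1, h2⟩ := h k _ _ (fun h0 => hij'.ne' ((Tuple.sort g).injective h0)) hne
  have := Tuple.monotone_sort g hij'.le
  simp [g, h1, h2] at this

/-- A decomposition whose middle factors are simultaneously triangular up to a permutation can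
be brought into generalized Schur form. -/
theorem IsTriangularAlong.exists_feasible {I R : ℕ} (hRI : R ≤ I) {S : Set (Fin R)}
    {U : Fin 2 → Matrix (Fin R) (Fin R) ℝ} (h : IsTriangularAlong S U)
    (A : Matrix (Fin I) (Fin R) ℝ) (B : Matrix (Fin R) (Fin R) ℝ) :
    ∃ G : GSD I R R, G.Feasible ∧ ∀ k, G.Qa * G.Rm k * G.Qbᵀ = A * U k * Bᵀ := by
  -- The permutation is absorbed into the columns of A and B before they are decomposed; the
  -- triangular factors then multiply into the middle.
  obtain ⟨e, he⟩ := h.exists_perm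
  obtain ⟨Q, T, hQ, hT, hA⟩ := exists_qr hRI (A.submatrix id e)
  obtain ⟨Q', T', hQ', hT', hB⟩ := exists_rq (B.submatrix id e)
  refine ⟨⟨Q, Q', fun k => T * (U k).submatrix e e * T'⟩,
    ⟨hQ, hQ', fun k => (hT.mul (he k)).mul hT'⟩, fun k => ?_⟩
  have h1 : Q * (T * (U k).submatrix e e * T') * Q'ᵀ =
      (Q * T) * (U k).submatrix e e * (T' * Q'ᵀ) := by simp only [Matrix.mul_assoc]
  simp only [h1, ← hA, ← hB, Matrix.transpose_submatrix, Matrix.submatrix_mul_equiv,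
    Matrix.submatrix_id_id]

/-- `Δ` is at most as long as the residual of `M` for any matrix in the closure of the
unfoldings of arrays of rank at most `R`. -/
def IsLeastResidual {I R : ℕ} (M Δ : Matrix (Fin I) (Fin 2 × Fin R) ℝ) : Prop :=
  ∀ (A : Matrix (Fin I) (Fin R) ℝ) (B : Matrix (Fin R) (Fin R) ℝ)
    (U : Fin 2 → Matrix (Fin R) (Fin R) ℝ) (S : Set (Fin R)), IsTriangularAlong S U →
    frobInner Δ Δ ≤ frobInner (M - A * joinSlices fun k => U k * Bᵀ)
      (M - A * joinSlices fun k => U k * Bᵀ)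

/-! ### Consequences of GSD optimality and of the strict second-order conditions. -/

namespace GSD

theorem unfold_toArray {I J R : ℕ} (G : GSD I J R) :
    G.toArray.unfold = joinSlices fun k => G.Qa * G.Rm k * G.Qbᵀ := rfl

/-- This frees the outer factors: A and B can be varied without preserving orthonormality. -/
theorem IsOptimal.isLeastResidual {I R : ℕ} (hRI : R ≤ I) {Z : ThreeWay I R 2} {G : GSD I R R}
    (hG : G.IsOptimal Z) : IsLeastResidual Z.unfold (Z - G.toArray).unfold := by
  intro A B U S hU
  obtain ⟨G', hG', h⟩ := hU.exists_feasible hRI A B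
  have h1 := hG.2 G' hG'
  rw [ThreeWay.frobSq_eq, ThreeWay.frobSq_eq, ThreeWay.unfold_sub Z G'.toArray,
    unfold_toArray G', funext h] at h1
  simpa only [mul_joinSlices, Matrix.mul_assoc] using h1

/-- At an optimum the diagonals of `R_k` and `Q_aᵀ Z_k Q_b` agree. -/
theorem IsOptimal.diag_eq {I J R : ℕ} {Z : ThreeWay I J 2} {G : GSD I J R}
    (hG : G.IsOptimal Z) (k : Fin 2) (i : Fin R) :
    (G.Qaᵀ * Z.slice k * G.Qb) i i = G.Rm k i i := by
  classical
  obtain ⟨⟨hQa, hQb, hR⟩, hmin⟩ := hG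
  -- Varying one diagonal entry of one slice preserves triangularity, and its first-order condition
  -- reads off the (i, i) entry of Qₐᵀ(Zₖ - QₐRₖQ_bᵀ)Q_b.
  set N : Fin 2 → Matrix (Fin R) (Fin R) ℝ := fun l => if l = k then Matrix.single i i 1 else 0
    with hN
  have h0 : frobInner (Z - G.toArray).unfold (joinSlices fun l => G.Qa * N l * G.Qbᵀ) = 0 := by
    refine frobInner_eq_zero_of_forall_le fun t => ?_
    have h1 := hmin ⟨G.Qa, G.Qb, fun l => G.Rm l + t • N l⟩ ⟨hQa, hQb, fun l => ?_⟩
    · rw [ThreeWay.frobSq_eq, ThreeWay.frobSq_eq] at h1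
      convert h1 using 1
      have : (Z - GSD.toArray ⟨G.Qa, G.Qb, fun l => G.Rm l + t • N l⟩).unfold =
          (Z - G.toArray).unfold - t • joinSlices fun l => G.Qa * N l * G.Qbᵀ := by
        rw [ThreeWay.unfold_sub, ThreeWay.unfold_sub, unfold_toArray, unfold_toArray]
        simp only [Matrix.mul_add, Matrix.add_mul, joinSlices_add, ← joinSlices_smul,
          Matrix.mul_smul, Matrix.smul_mul]
        abel
      rw [this]
    · refine (hR l).add fun a b hab => ?_
      have hab' : b < a := hab
      by_cases hl : l = k
      · have : ¬ (i = a ∧ i = b) := fun h => hab'.ne (h.2.symm.trans h.1)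
        simp [hN, hl, this]
      · simp [hN, hl]
  have h2 : frobInner (Z - G.toArray).unfold (joinSlices fun l => G.Qa * N l * G.Qbᵀ) =
      (G.Qaᵀ * (Z.slice k - G.Qa * G.Rm k * G.Qbᵀ) * G.Qb) i i := by
    have h3 : (joinSlices fun l => G.Qa * N l * G.Qbᵀ) =
        Matrix.vecMulVec (fun a => G.Qa a i)
          (fun q : Fin 2 × Fin J => if q.1 = k then G.Qb q.2 i else 0) := by
      ext a q
      rw [joinSlices_apply, Matrix.vecMulVec_apply]
      by_cases hq : q.1 = k
      · simp only [hN, hq, if_true]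
        rw [Matrix.mul_assoc, Matrix.mul_apply, Finset.sum_eq_single i]
        · simp
        · intro b _ hb
          simp [Matrix.single_mul_apply_of_ne, hb]
        · simp
      · simp [hN, hq]
    rw [h3, frobInner_vecMulVec, Matrix.mul_assoc, Matrix.mul_apply]
    refine Finset.sum_congr rfl fun a _ => ?_
    congr 1
    simp only [Matrix.mulVec, dotProduct, Fintype.sum_prod_type, Matrix.mul_apply]
    rw [Finset.sum_eq_single k (fun l _ hl => by simp [hl]) (by simp)]
    simp [ThreeWay.unfold, ThreeWay.slice, GSD.toArray, ThreeWay.ofSlices]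
  rw [h2, Matrix.mul_sub, Matrix.sub_mul] at h0
  have h4 : G.Qaᵀ * (G.Qa * G.Rm k * G.Qbᵀ) * G.Qb = G.Rm k := by
    calc G.Qaᵀ * (G.Qa * G.Rm k * G.Qbᵀ) * G.Qb
        = (G.Qaᵀ * G.Qa) * G.Rm k * (G.Qbᵀ * G.Qb) := by simp only [Matrix.mul_assoc]
      _ = G.Rm k := by rw [hQa, hQb, Matrix.one_mul, Matrix.mul_one]
  rw [h4, Matrix.sub_apply] at h0
  linarith

/-- For adjacent indices the sums have a single term: the row condition for (i, i+1) bounds the i-th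
diagonal term strictly below by a square norm, and the column condition for (i-1, i) handles the
last index. -/
theorem StrictSecondOrder.tildeSq_pos {I J R : ℕ} (hR : 2 ≤ R) {Z : ThreeWay I J 2}
    {G : GSD I J R} (h : G.StrictSecondOrder Z) (i : Fin R) : 0 < G.tildeSq Z i i := by
  have hnn : ∀ a b, 0 ≤ G.tildeSq Z a b := fun a b => Finset.sum_nonneg fun k _ => sq_nonneg _
  by_cases hi : (i : ℕ) + 1 < R
  · have h1 := (h i ⟨i + 1, hi⟩ (by simp [Fin.lt_def])).1
    have h2 : Finset.Ico i ⟨i + 1, hi⟩ = {i} := by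
      ext a
      simp only [Finset.mem_Ico, Finset.mem_singleton, Fin.le_def, Fin.lt_def, Fin.ext_iff]
      omega
    rw [h2, Finset.sum_singleton, Finset.sum_singleton] at h1
    linarith [hnn ⟨i + 1, hi⟩ i]
  · have hi1 : (i : ℕ) - 1 < R := by omega
    have h1 := (h ⟨i - 1, hi1⟩ i (by simp only [Fin.lt_def]; omega)).2
    have h2 : Finset.Ioc ⟨i - 1, hi1⟩ i = {i} := by
      ext a
      simp only [Finset.mem_Ioc, Finset.mem_singleton, Fin.le_def, Fin.lt_def, Fin.ext_iff]
      omega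
    rw [h2, Finset.sum_singleton, Finset.sum_singleton] at h1
    linarith [hnn i ⟨i - 1, hi1⟩]

end GSD

/-- A pencil of upper triangular matrices without common zero on the diagonal is regular. -/
theorem exists_det_add_smul_ne_zero {R : ℕ} {T : Fin 2 → Matrix (Fin R) (Fin R) ℝ}
    (hT : ∀ k, (T k).BlockTriangular id) (hd : ∀ i, ∃ k, T k i i ≠ 0) :
    ∃ c : Fin 2 → ℝ, (∑ k, c k • T k).det ≠ 0 := by
  -- With c = (1, s) the determinant is the product of the affine factors T₀ᵢᵢ + s T₁ᵢᵢ, each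
  -- vanishing for at most one s.
  have hfin : (⋃ i : Fin R, {s : ℝ | T 0 i i + s * T 1 i i = 0}).Finite := by
    refine Set.finite_iUnion fun i => Set.Subsingleton.finite ?_
    intro s hs t ht
    have hs' : T 0 i i + s * T 1 i i = 0 := hs
    have ht' : T 0 i i + t * T 1 i i = 0 := ht
    have h1 : T 1 i i ≠ 0 := by
      intro h1
      obtain ⟨k, hk⟩ := hd i
      fin_cases k
      · exact hk (by simpa [h1] using hs')
      · exact hk h1
    exact mul_right_cancel₀ h1 (by linarith)
  obtain ⟨s, hs⟩ := hfin.exists_notMem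
  refine ⟨![1, s], ?_⟩
  have htri : (∑ k, (![1, s] : Fin 2 → ℝ) k • T k).BlockTriangular id := by
    intro i j hij
    simp [Fin.sum_univ_two, hT _ hij]
  rw [Matrix.det_of_isUpperTriangular htri, Finset.prod_ne_zero_iff]
  intro i _ h0
  refine hs (Set.mem_iUnion.2 ⟨i, ?_⟩)
  simpa [Fin.sum_univ_two] using h0

/-! ### First-order conditions. -/

namespace IsLeastResidual

variable {I R : ℕ} {M Δ : Matrix (Fin I) (Fin 2 × Fin R) ℝ} {A : Matrix (Fin I) (Fin R) ℝ}
  {B : Matrix (Fin R) (Fin R) ℝ} {d : Fin 2 → Fin R → ℝ}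

/-- Moving A in the direction ΔVᵀ changes the objective to first order by a multiple of |ΔVᵀ|². -/
theorem mul_transpose_eq_zero (h : IsLeastResidual M Δ)
    (hM : M = (A * joinSlices fun k => Matrix.diagonal (d k) * Bᵀ) + Δ) :
    Δ * (joinSlices fun k => Matrix.diagonal (d k) * Bᵀ)ᵀ = 0 := by
  set V := joinSlices fun k => Matrix.diagonal (d k) * Bᵀ with hV
  rw [← frobInner_self_eq_zero, ← frobInner_mul_right]
  refine frobInner_eq_zero_of_forall_le fun t => ?_
  have h1 := h (A + t • (Δ * Vᵀ)) B _ ∅ (isTriangularAlong_diagonal ∅ d)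
  rw [← hV] at h1
  convert h1 using 1
  have : M - (A + t • (Δ * Vᵀ)) * V = Δ - t • (Δ * Vᵀ * V) := by
    rw [hM, Matrix.add_mul, Matrix.smul_mul]
    abel
  rw [this]

/-- Adding a multiple of the matrix unit (i, j) to a diagonal slice leaves the pencil triangular
along {i}. Hence each row of each slice of AᵀΔ is orthogonal to all columns of B, which is
invertible. -/
theorem transpose_mul_eq_zero (h : IsLeastResidual M Δ) (hB : IsUnit B)
    (hM : M = (A * joinSlices fun k => Matrix.diagonal (d k) * Bᵀ) + Δ) : Aᵀ * Δ = 0 := by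
  classical
  have key : ∀ k i j, ∑ q, (Aᵀ * Δ) i (k, q) * B q j = 0 := by
    intro k i j
    set N : Fin 2 → Matrix (Fin R) (Fin R) ℝ :=
      fun l => if l = k then Matrix.single i j 1 else 0 with hN
    have h0 : frobInner Δ (A * joinSlices fun l => N l * Bᵀ) = 0 := by
      refine frobInner_eq_zero_of_forall_le fun t => ?_
      have h1 := h A B (fun l => Matrix.diagonal (d l) + t • N l) {i} ?_
      · convert h1 using 1
        have : (M - A * joinSlices fun l => (Matrix.diagonal (d l) + t • N l) * Bᵀ) =
            Δ - t • (A * joinSlices fun l => N l * Bᵀ) := by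
          simp only [Matrix.add_mul, Matrix.smul_mul, joinSlices_add, joinSlices_smul,
            Matrix.mul_add, Matrix.mul_smul, hM]
          abel
        rw [this]
      · intro l a b hab hne
        by_cases hl : l = k
        · simp only [hN, hl, if_true, Matrix.add_apply, Matrix.diagonal_apply_ne _ hab,
            Matrix.smul_apply, Matrix.single_apply, zero_add] at hne
          by_cases hc : i = a ∧ j = b
          · obtain ⟨rfl, rfl⟩ := hc
            exact ⟨rfl, fun hb => hab (Set.mem_singleton_iff.1 hb).symm⟩
          · simp [hc] at hne
        · simp [hN, hl, Matrix.diagonal_apply_ne _ hab] at hne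
    rw [frobInner_mul_left] at h0
    have h3 : (joinSlices fun l => N l * Bᵀ) = Matrix.vecMulVec (Pi.single i 1)
        (fun q : Fin 2 × Fin R => if q.1 = k then B q.2 j else 0) := by
      ext a q
      rw [joinSlices_apply, Matrix.vecMulVec_apply]
      by_cases hq : q.1 = k
      · simp only [hN, hq, if_true]
        by_cases ha : a = i
        · subst ha; simp
        · simp [Matrix.single_mul_apply_of_ne, ha]
      · simp [hN, hq]
    rw [h3, frobInner_vecMulVec, single_one_dotProduct] at h0
    simp only [Matrix.mulVec, dotProduct, Fintype.sum_prod_type] at h0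
    rw [Finset.sum_eq_single k (fun l _ hl => by simp [hl]) (by simp)] at h0
    simpa using h0
  ext i ⟨k, q⟩
  have h1 : (fun q => (Aᵀ * Δ) i (k, q)) ᵥ* B = 0 := funext fun j => key k i j
  have h2 : (fun q => (Aᵀ * Δ) i (k, q)) = 0 := by
    refine Matrix.vecMul_injective_of_isUnit hB ?_
    simpa using h1
  exact congrFun h2 q

end IsLeastResidual

/-! ### Rearranging decompositions and perturbing diagonal pencils. -/

section Decomposition

variable {m n : Type*} {R : ℕ}

theorem mul_diagonal_mul_transpose_apply (A : Matrix m (Fin R) ℝ) (B : Matrix n (Fin R) ℝ)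
    (d : Fin R → ℝ) (a : m) (b : n) :
    (A * Matrix.diagonal d * Bᵀ) a b = ∑ r, A a r * d r * B b r := by
  rw [Matrix.mul_apply]
  exact Finset.sum_congr rfl fun r _ => by rw [Matrix.mul_diagonal, Matrix.transpose_apply]

/-- Two terms of a decomposition with parallel third factors can be rearranged so that one of
them no longer contributes to the vector `A z`. -/
theorem exists_rearrangement (A : Matrix m (Fin R) ℝ) (B : Matrix n (Fin R) ℝ)
    (d : Fin 2 → Fin R → ℝ) (z : Fin R → ℝ) {i j : Fin R} (hij : i ≠ j) (hi : z i ≠ 0)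
    {γ : ℝ} (hγ : ∀ k, d k i = γ * d k j) :
    ∃ (A' : Matrix m (Fin R) ℝ) (B' : Matrix n (Fin R) ℝ) (d' : Fin 2 → Fin R → ℝ),
      (∀ k, A' * Matrix.diagonal (d' k) * B'ᵀ = A * Matrix.diagonal (d k) * Bᵀ) ∧
      A' *ᵥ Function.update (Function.update z i 1) j 0 = A *ᵥ z := by
  -- With dᵢ = γdⱼ, the two terms carry the matrix γaᵢbᵢᵀ + aⱼbⱼᵀ, which equals (zᵢaᵢ +
  -- zⱼaⱼ)(γ/zᵢ)bᵢᵀ + aⱼ(bⱼ - (γzⱼ/zᵢ)bᵢ)ᵀ.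
  refine ⟨Matrix.of fun a => Function.update (A a) i (z i * A a i + z j * A a j),
    Matrix.of fun b => Function.update (Function.update (B b) i (γ / z i * B b i)) j
      (B b j - γ * z j / z i * B b i),
    fun k => Function.update (d k) i (d k j), fun k => ?_, ?_⟩
  · ext a b
    rw [mul_diagonal_mul_transpose_apply, mul_diagonal_mul_transpose_apply, ← sub_eq_zero,
      ← Finset.sum_sub_distrib, Fintype.sum_eq_add i j hij]
    · simp only [Matrix.of_apply, Function.update_self, Function.update_of_ne hij,
        Function.update_of_ne hij.symm, hγ]
      field_simp
      ring
    · rintro r ⟨hri, hrj⟩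
      simp [hri, hrj]
  · ext a
    simp only [Matrix.mulVec, dotProduct, Matrix.of_apply]
    rw [← sub_eq_zero, ← Finset.sum_sub_distrib, Fintype.sum_eq_add i j hij]
    · simp only [Function.update_self, Function.update_of_ne hij, Function.update_of_ne hij.symm]
      ring
    · rintro r ⟨hri, hrj⟩
      simp [hri, hrj]

theorem exists_eq_mul_of_parallel {d : Fin 2 → Fin R → ℝ} {i j : Fin R} (hj : ∃ k, d k j ≠ 0)
    (h : d 0 i * d 1 j = d 1 i * d 0 j) : ∃ γ : ℝ, ∀ k, d k i = γ * d k j := by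
  obtain ⟨k, hk⟩ := hj
  refine ⟨d k i / d k j, fun l => ?_⟩
  rw [div_mul_eq_mul_div, eq_div_iff hk]
  fin_cases k <;> fin_cases l <;> simp <;> linarith

/-- Among the decompositions of a pencil one can choose one for which the terms contributing to a
given vector `A z` have pairwise non-parallel third factors. -/
theorem exists_decomposition_nonparallel {Y : Fin 2 → Matrix m n ℝ}
    (hY : ∀ (A : Matrix m (Fin R) ℝ) (B : Matrix n (Fin R) ℝ) (d : Fin 2 → Fin R → ℝ),
      (∀ k, Y k = A * Matrix.diagonal (d k) * Bᵀ) → ∀ i, ∃ k, d k i ≠ 0)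
    (A : Matrix m (Fin R) ℝ) (B : Matrix n (Fin R) ℝ) (d : Fin 2 → Fin R → ℝ)
    (hd : ∀ k, Y k = A * Matrix.diagonal (d k) * Bᵀ) (z : Fin R → ℝ) :
    ∃ (A' : Matrix m (Fin R) ℝ) (B' : Matrix n (Fin R) ℝ) (d' : Fin 2 → Fin R → ℝ)
      (z' : Fin R → ℝ), (∀ k, Y k = A' * Matrix.diagonal (d' k) * B'ᵀ) ∧ A' *ᵥ z' = A *ᵥ z ∧
      ∀ i j, i ≠ j → z' i ≠ 0 → z' j ≠ 0 → d' 0 i * d' 1 j ≠ d' 1 i * d' 0 j := by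
  classical
  -- Induction on the support of z: each rearrangement of a parallel pair removes one index from it.
  induction hs : (Finset.univ.filter fun r => z r ≠ 0).card using Nat.strong_induction_on
    generalizing A B d z with
  | _ s ih =>
    by_cases hgood : ∀ i j, i ≠ j → z i ≠ 0 → z j ≠ 0 → d 0 i * d 1 j ≠ d 1 i * d 0 j
    · exact ⟨A, B, d, z, hd, rfl, hgood⟩
    · push Not at hgood
      obtain ⟨i, j, hij, hi, hj, hpar⟩ := hgood
      obtain ⟨γ, hγ⟩ := exists_eq_mul_of_parallel (hY A B d hd j) hpar
      obtain ⟨A', B', d', h1, h2⟩ := exists_rearrangement A B d z hij hi hγ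
      rw [← h2]
      refine ih _ ?_ A' B' d' (fun k => by rw [h1, hd]) _ rfl
      rw [← hs]
      refine Finset.card_lt_card ⟨fun r hr => ?_, fun hsub => ?_⟩
      · simp only [Finset.mem_filter, Finset.mem_univ, true_and] at hr ⊢
        by_cases hrj : r = j
        · simp [hrj] at hr
        · by_cases hri : r = i
          · rwa [hri]
          · simpa [hrj, hri] using hr
      · have := hsub (Finset.mem_filter.2 ⟨Finset.mem_univ j, hj⟩)
        simp at this

/-- Any first-order perturbation `N` of a diagonal pencil is, up to entries at positions of
parallel diagonal entries, produced by row and column operations. -/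
theorem exists_commutator_correction (d : Fin 2 → Fin R → ℝ)
    (N : Fin 2 → Matrix (Fin R) (Fin R) ℝ) :
    ∃ (F H : Matrix (Fin R) (Fin R) ℝ) (T : Fin 2 → Matrix (Fin R) (Fin R) ℝ),
      (∀ k, F * Matrix.diagonal (d k) + T k + Matrix.diagonal (d k) * H = N k) ∧
      ∀ k i j, T k i j ≠ 0 → d 0 i * d 1 j = d 1 i * d 0 j ∧ N k i j ≠ 0 := by
  have key : ∀ i j, ∃ (f h : ℝ) (t : Fin 2 → ℝ),
      (∀ k, f * d k j + t k + d k i * h = N k i j) ∧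
      ∀ k, t k ≠ 0 → d 0 i * d 1 j = d 1 i * d 0 j ∧ N k i j ≠ 0 := by
    intro i j
    by_cases hpar : d 0 i * d 1 j = d 1 i * d 0 j
    · exact ⟨0, 0, fun k => N k i j, by simp, fun k hk => ⟨hpar, hk⟩⟩
    · have hdet : d 0 j * d 1 i - d 1 j * d 0 i ≠ 0 := fun h0 => hpar (by linarith)
      -- Cramer's rule for f dₖⱼ + h dₖᵢ = Nₖᵢⱼ, k = 0, 1.
      refine ⟨(N 0 i j * d 1 i - N 1 i j * d 0 i) / (d 0 j * d 1 i - d 1 j * d 0 i),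
        (d 0 j * N 1 i j - d 1 j * N 0 i j) / (d 0 j * d 1 i - d 1 j * d 0 i), 0,
        fun k => ?_, fun k hk => absurd rfl hk⟩
      rw [← sub_eq_zero]
      fin_cases k <;> simp <;> field_simp <;> ring
  choose f h t h1 h2 using key
  refine ⟨Matrix.of f, Matrix.of h, fun k => Matrix.of fun i j => t i j k, fun k => ?_,
    fun k i j => h2 i j k⟩
  ext i j
  simp [Matrix.mul_diagonal, Matrix.diagonal_mul, h1]

end Decomposition

/-! ### Regular pencils. -/

section Regular

/-- The determinant factors as det(PA) · ∏ᵢ(Σₖ cₖdₖᵢ) · det B. The conclusion holds for every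
decomposition, as needed after a rearrangement. -/
theorem isUnit_and_ne_zero_of_regular {m : Type*} [Fintype m] {R : ℕ}
    {Y : Fin 2 → Matrix m (Fin R) ℝ} {P : Matrix (Fin R) m ℝ} {c : Fin 2 → ℝ}
    (hreg : (P * ∑ k, c k • Y k).det ≠ 0) (A : Matrix m (Fin R) ℝ)
    (B : Matrix (Fin R) (Fin R) ℝ) (d : Fin 2 → Fin R → ℝ)
    (hd : ∀ k, Y k = A * Matrix.diagonal (d k) * Bᵀ) :
    IsUnit (P * A) ∧ IsUnit B ∧ ∀ i, ∃ k, d k i ≠ 0 := by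
  have h1 : P * ∑ k, c k • Y k = (P * A) * Matrix.diagonal (∑ k, c k • d k) * Bᵀ := by
    have : Matrix.diagonal (∑ k, c k • d k) = ∑ k, c k • Matrix.diagonal (d k) := by
      rw [Fin.sum_univ_two, Fin.sum_univ_two, ← Matrix.diagonal_smul, ← Matrix.diagonal_smul,
        Matrix.diagonal_add]
      rfl
    rw [this]
    simp only [Fin.sum_univ_two, hd, Matrix.mul_add, Matrix.add_mul, Matrix.mul_smul,
      Matrix.smul_mul, Matrix.mul_assoc]
  rw [h1, Matrix.det_mul, Matrix.det_mul, Matrix.det_transpose, Matrix.det_diagonal] at hreg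
  have h2 := right_ne_zero_of_mul hreg
  have h3 := left_ne_zero_of_mul hreg
  refine ⟨(Matrix.isUnit_iff_isUnit_det _).2 (left_ne_zero_of_mul h3).isUnit,
    (Matrix.isUnit_iff_isUnit_det _).2 h2.isUnit, fun i => ?_⟩
  by_contra h0
  push Not at h0
  refine Finset.prod_ne_zero_iff.1 (right_ne_zero_of_mul h3) i (Finset.mem_univ i) ?_
  simp [h0]

end Regular

/-! ### Second-order condition. -/

namespace IsLeastResidual

variable {I R : ℕ} {M Δ : Matrix (Fin I) (Fin 2 × Fin R) ℝ}

/-- The second-order condition: no vector `u` orthogonal to the columns of `A` can profitably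
replace a vector in the column space of `A`. -/
theorem second_order_of_nonparallel (h : IsLeastResidual M Δ)
    {A : Matrix (Fin I) (Fin R) ℝ} {B : Matrix (Fin R) (Fin R) ℝ} {d : Fin 2 → Fin R → ℝ}
    (hB : IsUnit B) {z : Fin R → ℝ}
    (hz : ∀ i j, i ≠ j → z i ≠ 0 → z j ≠ 0 → d 0 i * d 1 j ≠ d 1 i * d 0 j)
    (hM : M = (A * joinSlices fun k => Matrix.diagonal (d k) * Bᵀ) + Δ)
    {u : Fin I → ℝ} (hu : Aᵀ *ᵥ u = 0) :
    (A *ᵥ z ⬝ᵥ A *ᵥ z) * (Δᵀ *ᵥ u ⬝ᵥ Δᵀ *ᵥ u) ≤ (u ⬝ᵥ u) *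
      (((A *ᵥ z) ᵥ* (A * joinSlices fun k => Matrix.diagonal (d k) * Bᵀ)) ⬝ᵥ
        ((A *ᵥ z) ᵥ* (A * joinSlices fun k => Matrix.diagonal (d k) * Bᵀ))) := by
  have hΔV := h.mul_transpose_eq_zero hM
  have hAΔ := h.transpose_mul_eq_zero hB hM
  set V := joinSlices fun k => Matrix.diagonal (d k) * Bᵀ with hV
  set y := A *ᵥ z with hy
  set v := Δᵀ *ᵥ u with hv
  set w := y ᵥ* A with hw
  -- The choice w = Aᵀy gives w·z = |y|² and wᵀV = yᵀ(AV); the outer factor moves by uwᵀ while the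
  -- inner one moves by zvᵀ.
  set E := Matrix.vecMulVec u w with hE
  set N : Fin 2 → Matrix (Fin R) (Fin R) ℝ :=
    fun k => Matrix.vecMulVec z (B⁻¹ *ᵥ fun q => v (k, q)) with hN
  have hNv : (joinSlices fun k => N k * Bᵀ) = Matrix.vecMulVec z v := by
    ext r ⟨k, q⟩
    rw [joinSlices_apply, hN, Matrix.vecMulVec_mul, Matrix.vecMul_transpose, Matrix.mulVec_mulVec,
      Matrix.mul_nonsing_inv _ ((Matrix.isUnit_iff_isUnit_det _).1 hB), Matrix.one_mulVec]
    rfl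
  obtain ⟨F, H, T, hT, hTne⟩ := exists_commutator_correction d N
  set D : Fin 2 → Matrix (Fin R) (Fin R) ℝ := fun k => Matrix.diagonal (d k) with hD
  set X₂ := joinSlices fun k => (F * T k + F * D k * H + T k * H) * Bᵀ with hX₂
  set X₃ := joinSlices fun k => (F * T k * H) * Bᵀ with hX₃
  -- The factors 1 + tF and 1 + tH make the first-order change of the inner factor equal to zvᵀ
  -- although the middle slices move only by Tₖ.
  have hcurve : ∀ t : ℝ, M - ((A + t • E) * (1 + t • F)) *
      (joinSlices fun k => (D k + t • T k) * (B * (1 + t • H)ᵀ)ᵀ) =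
      Δ - (t • (E * V + A * Matrix.vecMulVec z v) +
        t ^ 2 • (E * Matrix.vecMulVec z v + A * X₂) + t ^ 3 • (E * X₂ + A * X₃) +
        t ^ 4 • (E * X₃)) := by
    intro t
    have h1 : (1 + t • F) * (joinSlices fun k => (D k + t • T k) * (B * (1 + t • H)ᵀ)ᵀ) =
        V + t • Matrix.vecMulVec z v + t ^ 2 • X₂ + t ^ 3 • X₃ := by
      rw [← hNv, hV, hX₂, hX₃, mul_joinSlices]
      simp only [← joinSlices_smul, ← joinSlices_add]
      congr 1
      funext k
      rw [← hT k, Matrix.transpose_mul, Matrix.transpose_transpose]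
      simp only [← Matrix.mul_assoc, ← Matrix.add_mul, ← Matrix.smul_mul]
      congr 1
      simp only [Matrix.mul_add, Matrix.add_mul, Matrix.mul_one, Matrix.one_mul, Matrix.smul_mul,
        Matrix.mul_smul, smul_add, smul_smul, Matrix.mul_assoc]
      module
    rw [Matrix.mul_assoc, h1, hM]
    simp only [Matrix.mul_add, Matrix.add_mul, Matrix.smul_mul, Matrix.mul_smul]
    module
  have hP0 : frobInner Δ (E * V + A * Matrix.vecMulVec z v) = 0 := by
    rw [frobInner_add_right, frobInner_mul_right, hΔV, frobInner_mul_left, hAΔ]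
    simp [frobInner]
  have h2 := frobInner_second_order hP0 (Q₀ := E * Matrix.vecMulVec z v + A * X₂)
    (Q₁ := E * X₂ + A * X₃) (Q₂ := E * X₃) fun t => by
      rw [← hcurve t]
      -- A nonzero off-diagonal entry of Tₖ lies in a row of the support of z and at a parallel
      -- pair; by `hz` its column is outside the support.
      refine h _ _ _ {i | z i ≠ 0} fun k i j hij hne => ?_
      have h3 : T k i j ≠ 0 := by
        intro h0
        simp [hD, Matrix.diagonal_apply_ne _ hij, h0] at hne
      obtain ⟨h4, h5⟩ := hTne k i j h3
      have h6 : z i ≠ 0 := by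
        intro h0
        simp [hN, Matrix.vecMulVec_apply, h0] at h5
      exact ⟨h6, fun h7 => hz i j hij h6 h7 h4⟩
  have hwz : w ⬝ᵥ z = y ⬝ᵥ y := by
    rw [hw, ← Matrix.dotProduct_mulVec]
  have huy : u ⬝ᵥ y = 0 := by
    rw [hy, Matrix.dotProduct_mulVec, ← Matrix.mulVec_transpose, hu, zero_dotProduct]
  have hEN : E * Matrix.vecMulVec z v = (y ⬝ᵥ y) • Matrix.vecMulVec u v := by
    rw [hE, Matrix.vecMulVec_mul_vecMulVec, hwz]
    ext
    simp only [Matrix.vecMulVec_apply, Matrix.smul_apply, Pi.smul_apply, smul_eq_mul]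
    ring
  have hEV : E * V = Matrix.vecMulVec u (y ᵥ* (A * V)) := by
    rw [hE, Matrix.vecMulVec_mul, hw, Matrix.vecMul_vecMul]
  have hAN : A * Matrix.vecMulVec z v = Matrix.vecMulVec y v := by
    rw [Matrix.mul_vecMulVec, hy]
  have hvv : ∀ (a c : Fin I → ℝ) (b e : Fin 2 × Fin R → ℝ),
      frobInner (Matrix.vecMulVec a b) (Matrix.vecMulVec c e) = (a ⬝ᵥ c) * (b ⬝ᵥ e) := by
    intro a c b e
    rw [frobInner_comm, frobInner_vecMulVec, Matrix.vecMulVec_mulVec]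
    simp [dotProduct_comm, mul_comm]
  have hΔuv : frobInner Δ (Matrix.vecMulVec u v) = v ⬝ᵥ v := by
    rw [frobInner_vecMulVec, Matrix.dotProduct_mulVec, ← Matrix.mulVec_transpose, ← hv]
  have hAX : frobInner Δ (A * X₂) = 0 := by
    rw [frobInner_mul_left, hAΔ]
    simp [frobInner]
  -- Here |P|² = |u|²|yᵀAV|² + |y|²|v|², the cross terms vanishing by u ⊥ y, while 2⟨Δ, Q₀⟩ =
  -- 2|y|²|v|².
  rw [hEN, hEV, hAN] at h2
  simp only [frobInner_add_left, frobInner_add_right, hvv, frobInner_smul_right, hΔuv, hAX, huy,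
    dotProduct_comm y u] at h2
  linarith

/-- The rearranged decomposition has the same Y and the same y = Az, so the non-parallel case
applies; u stays orthogonal to its columns because B' is invertible and no third factor vanishes. -/
theorem second_order (h : IsLeastResidual M Δ) {Y : Fin 2 → Matrix (Fin I) (Fin R) ℝ}
    (hM : M = joinSlices Y + Δ) {P : Matrix (Fin R) (Fin I) ℝ} {c : Fin 2 → ℝ}
    (hreg : (P * ∑ k, c k • Y k).det ≠ 0)
    {A : Matrix (Fin I) (Fin R) ℝ} {B : Matrix (Fin R) (Fin R) ℝ} {d : Fin 2 → Fin R → ℝ}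
    (hd : ∀ k, Y k = A * Matrix.diagonal (d k) * Bᵀ) (z : Fin R → ℝ)
    {u : Fin I → ℝ} (hu : ∀ k, (Y k)ᵀ *ᵥ u = 0) :
    (A *ᵥ z ⬝ᵥ A *ᵥ z) * (Δᵀ *ᵥ u ⬝ᵥ Δᵀ *ᵥ u) ≤ (u ⬝ᵥ u) *
      (((A *ᵥ z) ᵥ* joinSlices Y) ⬝ᵥ ((A *ᵥ z) ᵥ* joinSlices Y)) := by
  obtain ⟨A', B', d', z', hd', hz, hnp⟩ := exists_decomposition_nonparallel
    (fun A B d hd => (isUnit_and_ne_zero_of_regular hreg A B d hd).2.2) A B d hd z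
  obtain ⟨-, hB', hne⟩ := isUnit_and_ne_zero_of_regular hreg A' B' d' hd'
  have hJ : joinSlices Y = A' * joinSlices fun k => Matrix.diagonal (d' k) * B'ᵀ := by
    rw [mul_joinSlices]
    congr 1
    funext k
    rw [hd', Matrix.mul_assoc]
  have hu' : A'ᵀ *ᵥ u = 0 := by
    have h1 : ∀ k, Matrix.diagonal (d' k) *ᵥ (A'ᵀ *ᵥ u) = 0 := by
      intro k
      have h2 := hu k
      rw [hd', Matrix.transpose_mul, Matrix.transpose_mul, Matrix.transpose_transpose,
        Matrix.diagonal_transpose, ← Matrix.mulVec_mulVec, ← Matrix.mulVec_mulVec] at h2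
      refine Matrix.mulVec_injective_of_isUnit hB' ?_
      rw [h2, Matrix.mulVec_zero]
    funext i
    obtain ⟨k, hk⟩ := hne i
    have h2 := congrFun (h1 k) i
    rw [Matrix.mulVec_diagonal] at h2
    exact (mul_eq_zero.1 h2).resolve_left hk
  rw [hJ] at hM ⊢
  rw [← hz]
  exact h.second_order_of_nonparallel hB' hnp hM hu'

end IsLeastResidual

/-! ### From the second-order condition to a global minimum. -/

section Optimality

variable {m n p : Type*} [Fintype m] [Fintype n] [Fintype p]

theorem frobInner_self_eq_sum_dotProduct (X : Matrix m n ℝ) :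
    frobInner X X = ∑ i, X i ⬝ᵥ X i := frobInner_eq_sum X X

theorem frobInner_transpose_self (X : Matrix m n ℝ) : frobInner Xᵀ Xᵀ = frobInner X X := by
  rw [frobInner, frobInner, Matrix.transpose_transpose, Matrix.trace_mul_comm]

/-- The squared length of the residual of a projection onto orthonormal columns. -/
theorem frobInner_sub_projection [DecidableEq p] {C : Matrix m p ℝ} (hC : Cᵀ * C = 1)
    (X : Matrix m n ℝ) : frobInner (X - C * (Cᵀ * X)) (X - C * (Cᵀ * X)) =
      frobInner X X - frobInner (Cᵀ * X) (Cᵀ * X) := by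
  have h1 : frobInner X (C * (Cᵀ * X)) = frobInner (Cᵀ * X) (Cᵀ * X) := frobInner_mul_left _ _ _
  have h2 : frobInner (C * (Cᵀ * X)) (C * (Cᵀ * X)) = frobInner (Cᵀ * X) (Cᵀ * X) := by
    rw [frobInner_mul_left, ← Matrix.mul_assoc Cᵀ C, hC, Matrix.one_mul]
  rw [frobInner_sub_left, frobInner_sub_right, frobInner_sub_right, h2, h1,
    frobInner_comm (C * (Cᵀ * X)) X, h1]
  ring

/-- A critical point `Q V` of the low-rank approximation problem for `Q V + Δ` at which the
second-order conditions hold is a global minimum. -/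
theorem frobInner_le_of_second_order [DecidableEq p] {Q : Matrix m p ℝ} {V : Matrix p n ℝ}
    {Δ : Matrix m n ℝ} (hQ : Qᵀ * Q = 1) (hQΔ : Qᵀ * Δ = 0) (hΔV : Δ * Vᵀ = 0)
    (h : ∀ (x : p → ℝ) (u : m → ℝ), Qᵀ *ᵥ u = 0 →
      (x ⬝ᵥ x) * ((u ᵥ* Δ) ⬝ᵥ (u ᵥ* Δ)) ≤ (u ⬝ᵥ u) * ((x ᵥ* V) ⬝ᵥ (x ᵥ* V)))
    {C : Matrix m p ℝ} (hC : Cᵀ * C = 1) :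
    frobInner Δ Δ ≤ frobInner (Q * V + Δ - C * (Cᵀ * (Q * V + Δ)))
      (Q * V + Δ - C * (Cᵀ * (Q * V + Δ))) := by
  set U := C - Q * (Qᵀ * C) with hU
  set W := Q - C * (Cᵀ * Q) with hW
  have hQU : Qᵀ * U = 0 := by
    rw [hU, Matrix.mul_sub, ← Matrix.mul_assoc Qᵀ Q, hQ, Matrix.one_mul, sub_self]
  have hUΔ : Uᵀ * Δ = Cᵀ * Δ := by
    rw [hU, Matrix.transpose_sub, Matrix.transpose_mul, Matrix.sub_mul, Matrix.mul_assoc _ Qᵀ, hQΔ,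
      Matrix.mul_zero, sub_zero]
  -- Both sides equal |Q|² - |CᵀQ|², as |C|² = |Q|².
  have hUW : frobInner Uᵀ Uᵀ = frobInner W W := by
    rw [frobInner_transpose_self, hU, hW, frobInner_sub_projection hQ,
      frobInner_sub_projection hC, show frobInner C C = frobInner Q Q by
        rw [frobInner, frobInner, hC, hQ], ← frobInner_transpose_self (Cᵀ * Q), Matrix.transpose_mul, Matrix.transpose_transpose]
  -- The hypothesis is summed over all pairs of a row of W and a column of U; the common factor |U|²
  -- = |W|² is cancelled afterwards.
  have hsum : frobInner W W * frobInner (Uᵀ * Δ) (Uᵀ * Δ) ≤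
      frobInner Uᵀ Uᵀ * frobInner (W * V) (W * V) := by
    simp only [frobInner_self_eq_sum_dotProduct]
    rw [Finset.sum_mul_sum, Finset.sum_mul_sum, Finset.sum_comm]
    refine Finset.sum_le_sum fun i _ => Finset.sum_le_sum fun j _ => ?_
    refine h (W j) (Uᵀ i) ?_
    funext r
    exact congrFun (congrFun hQU r) i
  have hle : frobInner (Uᵀ * Δ) (Uᵀ * Δ) ≤ frobInner (W * V) (W * V) := by
    rcases (frobInner_self_nonneg Uᵀ).eq_or_lt with h0 | h0
    · rw [frobInner_self_eq_zero.1 h0.symm, Matrix.zero_mul, frobInner_self_eq_zero.2 rfl]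
      exact frobInner_self_nonneg _
    · rw [← hUW] at hsum
      exact le_of_mul_le_mul_left hsum h0
  have hsplit : Q * V + Δ - C * (Cᵀ * (Q * V + Δ)) = W * V + (Δ - C * (Cᵀ * Δ)) := by
    rw [hW, Matrix.sub_mul, Matrix.mul_add, Matrix.mul_add]
    simp only [Matrix.mul_assoc]
    abel
  have hcross : frobInner (Δ - C * (Cᵀ * Δ)) (W * V) = 0 := by
    rw [frobInner_mul_right, Matrix.sub_mul, Matrix.mul_assoc C, Matrix.mul_assoc Cᵀ, hΔV]
    simp [frobInner]
  -- By orthogonality the residual is |WV|² + |Δ|² - |UᵀΔ|².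
  rw [hsplit, frobInner_add_left, frobInner_add_right, frobInner_add_right, hcross,
    frobInner_comm (W * V) (Δ - _), hcross, frobInner_sub_projection hC, ← hUΔ]
  linarith

end Optimality

/-! ### Assembly: rank at most R implies relaxed optimality. -/

namespace ThreeWay

/-- An array that is a sum of at most `R` rank-one arrays has simultaneously diagonalized
slices. -/
theorem exists_slices_eq_of_rank_le {R : ℕ} {T : Fin 2 → Matrix (Fin R) (Fin R) ℝ}
    (h : rank (ofSlices T) ≤ R) :
    ∃ (A B : Matrix (Fin R) (Fin R) ℝ) (d : Fin 2 → Fin R → ℝ),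
      ∀ k, T k = A * Matrix.diagonal (d k) * Bᵀ := by
  obtain ⟨S, hS, hsum⟩ := isSumOfRankOnes_rank (ofSlices T)
  choose a b c _ _ _ hE using hS
  generalize rank (ofSlices T) = n at *
  -- When fewer than R rank-one terms occur, the remaining columns are filled with zeros.
  refine ⟨Matrix.of fun i r => if hr : (r : ℕ) < n then a ⟨r, hr⟩ i else 0,
    Matrix.of fun j r => if hr : (r : ℕ) < n then b ⟨r, hr⟩ j else 0,
    fun k r => if hr : (r : ℕ) < n then c ⟨r, hr⟩ k else 0, fun k => ?_⟩
  ext i j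
  rw [mul_diagonal_mul_transpose_apply]
  have h1 : T k i j = ∑ r, S r i j k := by
    have := congrFun (congrFun (congrFun hsum i) j) k
    simpa [ofSlices, Finset.sum_apply] using this
  rw [h1, ← Finset.sum_subset (s₁ := Finset.univ.map (Fin.castLEEmb h)) (Finset.subset_univ _)]
  · rw [Finset.sum_map]
    refine Finset.sum_congr rfl fun r _ => ?_
    simp only [hE, Matrix.of_apply, Fin.castLEEmb_apply, Fin.val_castLE, r.2, dif_pos, Fin.eta]
    ring
  · intro r _ hr
    have : ¬ (r : ℕ) < n := fun hlt =>
      hr (Finset.mem_map.2 ⟨⟨r, hlt⟩, Finset.mem_univ _, by simp⟩)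
    simp [this]

end ThreeWay

namespace GSD

/-- Matrices with orthonormal columns are injective, so rank-one terms are carried to rank-one terms
with nonzero factors. -/
theorem rank_toArray_le {I J R : ℕ} {G : GSD I J R} (hG : G.Feasible) :
    ThreeWay.rank G.toArray ≤ ThreeWay.rank (ThreeWay.ofSlices G.Rm) := by
  obtain ⟨S, hS, hsum⟩ := ThreeWay.isSumOfRankOnes_rank (ThreeWay.ofSlices G.Rm)
  choose a b c ha hb hc hE using hS
  have hinj : ∀ {q : ℕ} {Q : Matrix (Fin q) (Fin R) ℝ}, Qᵀ * Q = 1 → ∀ x : Fin R → ℝ,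
      x ≠ 0 → Q *ᵥ x ≠ 0 := by
    intro q Q hQ x hx h0
    refine hx ?_
    rw [← Matrix.one_mulVec x, ← hQ, ← Matrix.mulVec_mulVec, h0, Matrix.mulVec_zero]
  refine Nat.sInf_le ⟨fun r i j k => (G.Qa *ᵥ a r) i * (G.Qb *ᵥ b r) j * c r k,
    fun r => ⟨_, _, _, hinj hG.1 _ (ha r), hinj hG.2.1 _ (hb r), hc r, fun _ _ _ => rfl⟩, ?_⟩
  funext i j k
  have h1 : G.Rm k = ∑ r, c r k • Matrix.vecMulVec (a r) (b r) := by
    ext p q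
    have := congrFun (congrFun (congrFun hsum p) q) k
    simp only [ThreeWay.ofSlices, Finset.sum_apply, hE] at this
    rw [this, Matrix.sum_apply]
    exact Finset.sum_congr rfl fun r _ => by
      rw [Matrix.smul_apply, Matrix.vecMulVec_apply, smul_eq_mul]; ring
  simp only [toArray, ThreeWay.ofSlices, h1, Matrix.mul_sum, Matrix.sum_mul, Matrix.sum_apply,
    Finset.sum_apply]
  refine Finset.sum_congr rfl fun r _ => ?_
  rw [Matrix.mul_smul, Matrix.smul_mul, Matrix.mul_vecMulVec, Matrix.vecMulVec_mul,
    Matrix.vecMul_transpose, Matrix.smul_apply, Matrix.vecMulVec_apply, smul_eq_mul]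
  ring

/-- An optimal generalized Schur decomposition whose triangular array has rank at most `R` and
which satisfies the strict second-order conditions solves the relaxed problem. -/
theorem IsOptimal.isBestFromW {I R : ℕ} (hR : 2 ≤ R) (hRI : R ≤ I) {Z : ThreeWay I R 2}
    {G : GSD I R R} (hG : G.IsOptimal Z) (hs : G.StrictSecondOrder Z)
    (hrank : ThreeWay.rank (ThreeWay.ofSlices G.Rm) ≤ R) :
    ThreeWay.IsBestFromW R Z G.toArray := by
  obtain ⟨hQa, hQb, htri⟩ := hG.1
  obtain ⟨A₀, B₀, d, hd⟩ := ThreeWay.exists_slices_eq_of_rank_le hrank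
  -- By `diag_eq`, a common diagonal zero of R₁ and R₂ would make a diagonal `tildeSq` vanish.
  obtain ⟨c, hc⟩ := exists_det_add_smul_ne_zero htri fun i => by
    by_contra h0
    push Not at h0
    have h1 := hs.tildeSq_pos hR i
    simp [tildeSq, hG.diag_eq, h0] at h1
  set Y : Fin 2 → Matrix (Fin I) (Fin R) ℝ := fun k => G.Qa * G.Rm k * G.Qbᵀ with hY
  have hYd : ∀ k, Y k = (G.Qa * A₀) * Matrix.diagonal (d k) * (G.Qb * B₀)ᵀ := fun k => by
    rw [hY, Matrix.transpose_mul]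
    simp only [hd, Matrix.mul_assoc]
  have hdetQb : G.Qbᵀ.det ≠ 0 := by
    intro h0
    have := congrArg Matrix.det hQb
    rw [Matrix.det_mul, h0, zero_mul, Matrix.det_one] at this
    exact zero_ne_one this
  have hreg : (G.Qaᵀ * ∑ k, c k • Y k).det ≠ 0 := by
    have : G.Qaᵀ * ∑ k, c k • Y k = (∑ k, c k • G.Rm k) * G.Qbᵀ := by
      rw [Matrix.mul_sum, Matrix.sum_mul]
      refine Finset.sum_congr rfl fun k _ => ?_
      rw [Matrix.mul_smul, Matrix.smul_mul, hY, ← Matrix.mul_assoc, ← Matrix.mul_assoc, hQa,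
        Matrix.one_mul]
    rw [this, Matrix.det_mul]
    exact mul_ne_zero hc hdetQb
  obtain ⟨hA₀, hB, -⟩ := isUnit_and_ne_zero_of_regular hreg _ _ _ hYd
  rw [← Matrix.mul_assoc, hQa, Matrix.one_mul, Matrix.isUnit_iff_isUnit_det] at hA₀
  set Δ := (Z - G.toArray).unfold with hΔ
  have hleast : IsLeastResidual Z.unfold Δ := hG.isLeastResidual hRI
  have hM : Z.unfold = joinSlices Y + Δ := by
    rw [hΔ, ThreeWay.unfold_sub, unfold_toArray]
    abel
  set V := joinSlices fun k => G.Rm k * G.Qbᵀ with hV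
  have hJV : joinSlices Y = G.Qa * V := by
    rw [hV, mul_joinSlices, hY]
    simp only [Matrix.mul_assoc]
  have hVA : V = A₀ * joinSlices fun k => Matrix.diagonal (d k) * (G.Qb * B₀)ᵀ := by
    rw [hV, mul_joinSlices]
    simp only [hd, Matrix.transpose_mul, Matrix.mul_assoc]
  have hM' : Z.unfold = ((G.Qa * A₀) * joinSlices fun k =>
      Matrix.diagonal (d k) * (G.Qb * B₀)ᵀ) + Δ := by
    rw [Matrix.mul_assoc, ← hVA, ← hJV, hM]
  have hΔV : Δ * Vᵀ = 0 := by
    rw [hVA, Matrix.transpose_mul, ← Matrix.mul_assoc, hleast.mul_transpose_eq_zero hM',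
      Matrix.zero_mul]
  have hQΔ : G.Qaᵀ * Δ = 0 := by
    have h1 := hleast.transpose_mul_eq_zero hB hM'
    rw [Matrix.transpose_mul, Matrix.mul_assoc] at h1
    rw [← Matrix.nonsing_inv_mul_cancel_left A₀ᵀ (G.Qaᵀ * Δ) (by rwa [Matrix.det_transpose]), h1,
      Matrix.mul_zero]
  have hsecond : ∀ (x : Fin R → ℝ) (u : Fin I → ℝ), G.Qaᵀ *ᵥ u = 0 →
      (x ⬝ᵥ x) * ((u ᵥ* Δ) ⬝ᵥ (u ᵥ* Δ)) ≤ (u ⬝ᵥ u) * ((x ᵥ* V) ⬝ᵥ (x ᵥ* V)) := by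
    intro x u hu
    -- The choice z = A₀⁻¹x gives y = Qₐx, so every vector of the column space of Qₐ is reached.
    have h1 := hleast.second_order hM hreg hYd (A₀⁻¹ *ᵥ x) (u := u) fun k => by
      rw [hY]
      simp only [Matrix.transpose_mul, ← Matrix.mulVec_mulVec, hu, Matrix.mulVec_zero]
    have h2 : (G.Qa * A₀) *ᵥ (A₀⁻¹ *ᵥ x) = G.Qa *ᵥ x := by
      rw [Matrix.mulVec_mulVec, Matrix.mul_assoc, Matrix.mul_nonsing_inv _ hA₀, Matrix.mul_one]
    have h3 : (G.Qa *ᵥ x) ᵥ* G.Qa = x := by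
      rw [← Matrix.mulVec_transpose, Matrix.mulVec_mulVec, hQa, Matrix.one_mulVec]
    have h4 : G.Qa *ᵥ x ⬝ᵥ G.Qa *ᵥ x = x ⬝ᵥ x := by
      rw [Matrix.dotProduct_mulVec, h3]
    rwa [h2, h4, hJV, ← Matrix.vecMul_vecMul, h3, Matrix.mulVec_transpose] at h1
  refine ⟨?_, fun X hX => ?_⟩
  · rw [ThreeWay.mem_W_iff, unfold_toArray, ← hY, hJV]
    exact (Matrix.rank_mul_le_left _ _).trans (Matrix.rank_le_width G.Qa)
  · obtain ⟨C, hC, hXC⟩ := ThreeWay.exists_projection_of_mem_W hRI hX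
    rw [ThreeWay.frobSq_eq, ThreeWay.frobSq_eq, ← hΔ, ThreeWay.unfold_sub, hXC]
    refine le_trans ?_ (ThreeWay.frobInner_sub_projection_le hC _ _)
    rw [hM, hJV]
    exact frobInner_le_of_second_order hQa hQΔ hΔV hsecond hC

end GSD

theorem theorem5p1 (I J R : ℕ) (hR : 2 ≤ R) (hJR : J = R) (hIJ : J < I) :
    ∀ᵐ Z : ThreeWay I J 2 ∂(volume : Measure (ThreeWay I J 2)),
      (∃! X : ThreeWay I J 2, ThreeWay.IsBestFromW R Z X) ∧
      ∀ X : ThreeWay I J 2, ThreeWay.IsBestFromW R Z X →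
        ∀ G : GSD I J R, GSD.IsOptimal Z G → GSD.StrictSecondOrder Z G →
          R < ThreeWay.rank X → R < ThreeWay.rank (ThreeWay.ofSlices G.Rm) := by
  subst hJR
  filter_upwards [ThreeWay.ae_existsUnique_isBestFromW hIJ.le] with Z hZ
  refine ⟨hZ, fun X hX G hG hs hXrank => ?_⟩
  by_contra hrank
  push Not at hrank
  rw [hZ.unique hX (hG.isBestFromW hR hIJ.le hs hrank)] at hXrank
  exact absurd ((GSD.rank_toArray_le hG.1).trans hrank) (not_le.2 hXrank)
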